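/- **Definitions.** For a complex $n\times n$ matrix $A$ and $1\le m\le n$, let $$\|A\|^{\delta}_{(m)}=\max\Big\{\Big|\sum_{j=1}^m\langle Ax_j,y_j\rangle\Big| : (x_j)_{j=1}^m,\ (y_j)_{j=1}^m \text{ orthonormal in } \mathbb{C}^n,\ \sum_{j=1}^m\langle x_j,y_j\rangle=0\Big\},$$ with $\|A\|^{\delta}_{(0)}=0$ and the maximum over an empty set (which occurs only for $n=m=1$) read as $0$. The discrepancy values of $A$ are $\delta_m(A)=\|A\|^{\delta}_{(m)}-\|A\|^{\delta}_{(m-1)}$, $1\le m\le n$. For $k$-dimensional subspaces $\mathcal S,\mathcal T\subset\mathbb{C}^n$, let $P$ be the orthogonal projection of $\mathbb{C}^n$ onto $\mathcal S$; the vector of principal angles is $\Theta(\mathcal S,\mathcal T)=(\arccos\sigma_1,\dots,\arccos\sigma_k)$, where $\sigma_1\ge\dots\ge\sigma_k$ are the singular values of the restriction $P|_{\mathcal T}:\mathcal T\to\mathcal S$. For $x,y\in\mathbb{R}^k$, $x\prec_w y$ (weak majorization) means that for every $m=1,\dots,k$ the sum of the $m$ largest entries of $x$ is at most the sum of the $m$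 largest entries of $y$. **Theorem.** Let $X$ be a Hermitian $n\times n$ complex matrix, let $\mathcal S\subset\mathbb{C}^n$ be a subspace of dimension $k$, let $\mathcal T=e^{iX}\mathcal S$, and put $h=\min(k,n-k)$. Then $$\Theta(\mathcal S,\mathcal T)\prec_w(\delta_1(X),\dots,\delta_h(X),\underbrace{0,\dots,0}_{k-h}).$$ -/

import Mathlib

open scoped InnerProductSpace

noncomputable section

namespace Discrepancy

/-- The decreasing rearrangement `x↓` of a real vector `x`. -/
def decreasing {p : ℕ} (x : Fin p → ℝ) : Fin p → ℝ :=
  fun i => x (Tuple.sort x i.rev)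

theorem antitone_decreasing {p : ℕ} (x : Fin p → ℝ) : Antitone (decreasing x) :=
  fun _ _ h => Tuple.monotone_sort x (Fin.rev_le_rev.mpr h)

/-- Weak majorization `x ≺_w y` of real vectors of the same length: for every `m`, the sum of the
`m` largest entries of `x` is at most the sum of the `m` largest entries of `y`. -/
def WeaklyMajorized {p : ℕ} (x y : Fin p → ℝ) : Prop :=
  ∀ m : ℕ, 1 ≤ m → m ≤ p →
    ∑ i ∈ Finset.univ.filter (fun i : Fin p => (i : ℕ) < m), decreasing x i ≤
      ∑ i ∈ Finset.univ.filter (fun i : Fin p => (i : ℕ) < m), decreasing y i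

/-- The `m`-th discrepancy (pseudo-)norm of a complex square matrix `A`: the maximum of
`|∑ j, ⟨A x_j, y_j⟩|` over orthonormal families `x_1, …, x_m` and `y_1, …, y_m` satisfying the
single constraint `∑ j, ⟨x_j, y_j⟩ = 0`; equivalently, of `|tr (A M)|` over the partial isometries
`M` of rank `m` with trace zero. For `m = 0` the value is `0`. -/
def discrepancyNorm {n : ℕ} (A : Matrix (Fin n) (Fin n) ℂ) (m : ℕ) : ℝ :=
  sSup {r : ℝ | ∃ x y : Fin m → EuclideanSpace ℂ (Fin n),
    Orthonormal ℂ x ∧ Orthonormal ℂ y ∧ ∑ j, ⟪x j, y j⟫_ℂ = 0 ∧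
      r = ‖∑ j, ⟪Matrix.toEuclideanLin A (x j), y j⟫_ℂ‖}

/-- The discrepancy value `δ_i(A) = ‖A‖^δ_(i) - ‖A‖^δ_(i-1)`, for `i ≥ 1`. -/
def discrepancyValue {n : ℕ} (A : Matrix (Fin n) (Fin n) ℂ) (i : ℕ) : ℝ :=
  discrepancyNorm A i - discrepancyNorm A (i - 1)

/-- The vector `(δ_1(A), …, δ_h(A), 0, …, 0)` of length `p`: the first `h` discrepancy values of
`A`, followed by zeros. -/
def firstDiscrepancyValues {n : ℕ} (A : Matrix (Fin n) (Fin n) ℂ) (h p : ℕ) : Fin p → ℝ :=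
  fun i => if (i : ℕ) < h then discrepancyValue A ((i : ℕ) + 1) else 0

/-- The principal angles between subspaces `S` and `T` of `ℂⁿ`: the arccosines of the singular
values of the orthogonal projection onto `S` restricted to `T` (these are the singular values of
`S* T`, where the columns of the matrices `S`, `T` are orthonormal bases of the subspaces).
The index starts at `0`, and the angles are those with index `i < min (dim S) (dim T)`. -/
def principalAngle {n : ℕ} (S T : Submodule ℂ (EuclideanSpace ℂ (Fin n))) (i : ℕ) : ℝ :=
  Real.arccos
    (LinearMap.singularValues (𝕜 := ℂ) (E := T) (F := S)
      (S.orthogonalProjectionOnto ∘L T.subtypeL).toLinearMap i)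

/-- The vector of the `k` principal angles between two subspaces of dimension `k`. -/
def principalAngles {n : ℕ} (k : ℕ) (S T : Submodule ℂ (EuclideanSpace ℂ (Fin n))) : Fin k → ℝ :=
  fun i => principalAngle S T i

end Discrepancy

end

noncomputable section

namespace Discrepancy

/-! Let `R = 2P - 1` be the reflection in `S`. Its compression to a `k`-dimensional subspace has
eigenvalues `2σ² - 1 = cos 2θ`, so the principal angles to `S` are, up to the constant π/4, the
values of the decreasing function `-arcsin(x) / 2` at these eigenvalues. The subspace is moved from
`T` back to `S`, where all angles vanish, by the flow `exp(tG)` with `G = -iX`, and the growth of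
the sum of the `m` largest angles is bounded.

Let `b_j` diagonalize the compression of `R` to the current subspace. To first order a step of
length `s` changes the eigenvalue `ν_j` by `2s Re⟨v_j, G b_j⟩`, where `v_j = R b_j - ν_j b_j`. The
`v_j` are orthogonal to each other and to all `b_i`, and `‖v_j‖ = √(1 - ν_j²)`, which is exactly
what the derivative of the arcsine cancels. The angles therefore change at a rate bounded by a sum
of `|⟨X b_j, v_j/‖v_j‖⟩|`, and the pairs `(b_j, v_j/‖v_j‖)` compete in the discrepancy norm because
each `⟨b_i, v_j⟩` is zero. At most `n - k` of the `v_j` are nonzero, whence the index `min m (n -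
k)` (`sum_norm_inner_le_discrepancyNorm`).

No differentiability of eigenvalues is needed. One step (`IsEigenframe.sum_angleProfile_le`)
compares old and new eigenframes through the weights `|⟨b'_i, U b_j⟩|²`, using tangent lines and a
rearrangement inequality. Steps of length `1/N` accumulate an error that tends to zero. Since the
arcsine is singular at ±1, it is first replaced by `arcsin(r x)` with `r < 1`, and `r → 1` at the
end. -/

/-! ### Rearrangement and partial sums. -/

theorem card_filter_val_lt {k m : ℕ} (hm : m ≤ k) :
    (Finset.univ.filter (fun i : Fin k => (i : ℕ) < m)).card = m := by
  rw [Fin.card_filter_val_lt, min_eq_right hm]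

/-- Among all weights in `[0, 1]` of total mass `m`, the weighted sum of an antitone family is
largest for the indicator of the first `m` indices. -/
theorem sum_mul_le_sum_of_antitone {k m : ℕ} (hm : m ≤ k) {q p : Fin k → ℝ} (hq : Antitone q)
    (hp0 : ∀ i, 0 ≤ p i) (hp1 : ∀ i, p i ≤ 1) (hp : ∑ i, p i = m) :
    ∑ i, p i * q i ≤ ∑ i ∈ Finset.univ.filter (fun i : Fin k => (i : ℕ) < m), q i := by
  obtain rfl | hm0 := Nat.eq_zero_or_pos m
  · have h0 : ∀ i, p i = 0 := by
      intro i
      have := (Finset.sum_eq_zero_iff_of_nonneg (fun i _ => hp0 i)).1 (by simpa using hp)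
      exact this i (Finset.mem_univ i)
    simp [h0]
  -- Subtracting the threshold `c`, the `m`-th largest value, costs nothing since both weights have
  -- mass `m`; then `indicator - p` and `q - c` have the same sign at every index.
  · set c := q ⟨m - 1, by omega⟩ with hc
    have hcard : ∑ i : Fin k, (if (i : ℕ) < m then (1 : ℝ) else 0) = m := by
      rw [Finset.sum_boole, card_filter_val_lt hm]
    have key : 0 ≤ ∑ i : Fin k, ((if (i : ℕ) < m then (1 : ℝ) else 0) - p i) * (q i - c) := by
      refine Finset.sum_nonneg fun i _ => ?_
      split_ifs with h
      · exact mul_nonneg (sub_nonneg.2 (hp1 i)) (sub_nonneg.2 (hq (Fin.mk_le_mk.2 (by omega))))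
      · have : q i ≤ c := hq (Fin.mk_le_mk.2 (by omega))
        nlinarith [hp0 i]
    have hexp : ∑ i : Fin k, ((if (i : ℕ) < m then (1 : ℝ) else 0) - p i) * (q i - c) =
        ∑ i : Fin k, (if (i : ℕ) < m then (1 : ℝ) else 0) * q i - ∑ i, p i * q i
          - ((∑ i : Fin k, (if (i : ℕ) < m then (1 : ℝ) else 0)) - ∑ i, p i) * c := by
      rw [← Finset.sum_sub_distrib, ← Finset.sum_sub_distrib, Finset.sum_mul,
        ← Finset.sum_sub_distrib]
      exact Finset.sum_congr rfl fun i _ => by ring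
    rw [hexp, hcard, hp, sub_self, zero_mul, sub_zero] at key
    rw [Finset.sum_filter]
    simpa [ite_mul] using sub_nonneg.1 key

theorem decreasing_of_monotone {p : ℕ} {x : Fin p → ℝ} (hx : Monotone x) (i : Fin p) :
    decreasing x i = x i.rev := by
  rw [decreasing, Tuple.sort_eq_refl_iff_monotone.2 hx, Equiv.refl_apply]

/-- This makes it unnecessary to know that the discrepancy values are decreasing: bounding by their
first `m` entries suffices. -/
theorem sum_filter_le_sum_decreasing {p m : ℕ} (hm : m ≤ p) (y : Fin p → ℝ) :
    ∑ i ∈ Finset.univ.filter (fun i : Fin p => (i : ℕ) < m), y i ≤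
      ∑ i ∈ Finset.univ.filter (fun i : Fin p => (i : ℕ) < m), decreasing y i := by
  set τ : Equiv.Perm (Fin p) := Fin.revPerm.trans (Tuple.sort y) with hτ
  have hy : ∀ i, decreasing y i = y (τ i) := fun i => rfl
  have hsum : ∑ i : Fin p, (if ((τ i : Fin p) : ℕ) < m then (1 : ℝ) else 0) = m := by
    rw [Equiv.sum_comp τ (fun i : Fin p => if (i : ℕ) < m then (1 : ℝ) else 0), Finset.sum_boole,
      card_filter_val_lt hm]
  refine le_trans (le_of_eq ?_) (sum_mul_le_sum_of_antitone hm (antitone_decreasing y)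
    (fun i => ?_) (fun i => ?_) hsum)
  · rw [Finset.sum_filter, ← Equiv.sum_comp τ]
    exact Finset.sum_congr rfl fun i _ => by rw [hy]; split_ifs <;> simp
  · split_ifs <;> norm_num
  · split_ifs <;> norm_num

/-- The differences telescope, and the zero padding stops the telescope at `h`. -/
theorem sum_firstDiscrepancyValues {n : ℕ} (A : Matrix (Fin n) (Fin n) ℂ) (h : ℕ) {p m : ℕ}
    (hm : m ≤ p) :
    ∑ i ∈ Finset.univ.filter (fun i : Fin p => (i : ℕ) < m), firstDiscrepancyValues A h p i =
      discrepancyNorm A (min m h) - discrepancyNorm A 0 := by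
  have h1 : ∑ i ∈ Finset.univ.filter (fun i : Fin p => (i : ℕ) < m),
      firstDiscrepancyValues A h p i =
      ∑ i ∈ Finset.range p, if i < m then (if i < h then discrepancyValue A (i + 1) else 0)
        else 0 := by
    rw [Finset.sum_filter, ← Fin.sum_univ_eq_sum_range
      (fun i => if i < m then (if i < h then discrepancyValue A (i + 1) else 0) else 0)]
    rfl
  have h2 : (Finset.range p).filter (fun i => i < m ∧ i < h) = Finset.range (min m h) := by
    ext i; simp only [Finset.mem_filter, Finset.mem_range]; omega
  rw [h1, ← Finset.sum_range_sub (discrepancyNorm A), ← h2, Finset.sum_filter]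
  refine Finset.sum_congr rfl fun i _ => ?_
  by_cases hi : i < m <;> by_cases hi' : i < h <;> simp [hi, hi', discrepancyValue]

theorem discrepancyNorm_zero {n : ℕ} (A : Matrix (Fin n) (Fin n) ℂ) : discrepancyNorm A 0 = 0 := by
  have : {r : ℝ | ∃ x y : Fin 0 → EuclideanSpace ℂ (Fin n),
    Orthonormal ℂ x ∧ Orthonormal ℂ y ∧ ∑ j, ⟪x j, y j⟫_ℂ = 0 ∧
      r = ‖∑ j, ⟪Matrix.toEuclideanLin A (x j), y j⟫_ℂ‖} = {0} := by
    ext r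
    simp only [Finset.univ_eq_empty, Finset.sum_empty, norm_zero, Set.mem_ofPred_eq,
      Set.mem_singleton_iff, true_and]
    constructor
    · rintro ⟨x, y, -, -, h⟩; exact h
    · intro h
      exact ⟨Fin.elim0, Fin.elim0, ⟨fun i => i.elim0, fun i => i.elim0⟩,
        ⟨fun i => i.elim0, fun i => i.elim0⟩, h⟩
  rw [discrepancyNorm, this, csSup_singleton]

/-! ### The regularized angle as a function of the eigenvalue. -/

/-- The profile `-arcsin (r x) / 2`, which for `r = 1` and `x = cos (2 θ)` is `θ - π / 4`. For
`r < 1` it is smooth on `[-1, 1]`. -/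
def angleProfile (r x : ℝ) : ℝ := -(Real.arcsin (r * x) / 2)

/-- The derivative of `angleProfile r`. -/
def angleProfileDeriv (r x : ℝ) : ℝ := -(r / √(1 - (r * x) ^ 2) / 2)

theorem antitone_angleProfile {r : ℝ} (hr : 0 ≤ r) : Antitone (angleProfile r) := by
  intro x y h
  have := Real.monotone_arcsin (mul_le_mul_of_nonneg_left h hr)
  simp only [angleProfile]; linarith

theorem one_sub_mul_sq_pos {r x : ℝ} (hr0 : 0 ≤ r) (hr1 : r < 1) (hx : x ^ 2 ≤ 1) :
    0 < 1 - (r * x) ^ 2 := by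
  have h1 : (r * x) ^ 2 ≤ r ^ 2 := by
    rw [mul_pow]; exact mul_le_of_le_one_right (sq_nonneg r) hx
  nlinarith

theorem hasDerivAt_angleProfile {r x : ℝ} (hr0 : 0 ≤ r) (hr1 : r < 1) (hx : x ^ 2 ≤ 1) :
    HasDerivAt (angleProfile r) (angleProfileDeriv r x) x := by
  have h := one_sub_mul_sq_pos hr0 hr1 hx
  have h1 : r * x ≠ -1 := by intro h2; rw [h2] at h; norm_num at h
  have h2 : r * x ≠ 1 := by intro h2; rw [h2] at h; norm_num at h
  have := (((Real.hasDerivAt_arcsin h1 h2).comp x ((hasDerivAt_id x).const_mul r)).div_const 2).neg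
  refine (this.congr_deriv ?_ :)
  rw [angleProfileDeriv]; ring

/-- At an eigenvalue `x` the root is the norm of the normal part, so the derivative of the profile
at most normalizes that vector, uniformly in `r`. -/
theorem abs_two_mul_angleProfileDeriv_le {r x : ℝ} (hr0 : 0 ≤ r) (hr1 : r < 1) (hx : x ^ 2 ≤ 1) :
    |2 * angleProfileDeriv r x| * √(1 - x ^ 2) ≤ 1 := by
  have h := one_sub_mul_sq_pos hr0 hr1 hx
  have hs : 0 < √(1 - (r * x) ^ 2) := Real.sqrt_pos.2 h
  have h1 : |2 * angleProfileDeriv r x| = r / √(1 - (r * x) ^ 2) := by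
    rw [angleProfileDeriv, show 2 * -(r / √(1 - (r * x) ^ 2) / 2) = -(r / √(1 - (r * x) ^ 2)) by
      ring, abs_neg, abs_of_nonneg (by positivity)]
  have h2 : √(1 - x ^ 2) ≤ √(1 - (r * x) ^ 2) := by
    refine Real.sqrt_le_sqrt ?_
    have hr2 : r ^ 2 * x ^ 2 ≤ 1 * x ^ 2 := by gcongr; nlinarith
    rw [mul_pow]; linarith
  rw [h1, div_mul_eq_mul_div, div_le_one hs]
  calc r * √(1 - x ^ 2) ≤ 1 * √(1 - x ^ 2) := by gcongr
    _ ≤ _ := by rw [one_mul]; exact h2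

theorem exists_lipschitz_angleProfileDeriv {r : ℝ} (hr0 : 0 ≤ r) (hr1 : r < 1) :
    ∃ K : NNReal, LipschitzOnWith K (angleProfileDeriv r) (Set.Icc (-1) 1) := by
  have hsq : ∀ x ∈ Set.Icc (-1 : ℝ) 1, x ^ 2 ≤ 1 := fun x hx => by nlinarith [hx.1, hx.2]
  have hd : ContDiffOn ℝ 1 (angleProfileDeriv r) (Set.Icc (-1) 1) := by
    intro x hx
    have h := one_sub_mul_sq_pos hr0 hr1 (hsq x hx)
    have h1 : ContDiffAt ℝ 1 (fun x : ℝ => 1 - (r * x) ^ 2) x := by fun_prop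
    exact (((contDiffAt_const.div (h1.sqrt h.ne') (Real.sqrt_pos.2 h).ne').div_const 2).neg
      ).contDiffWithinAt
  exact hd.exists_lipschitzOnWith one_ne_zero (convex_Icc _ _) isCompact_Icc

/-- A quadratic lower bound for `angleProfile r` by its tangent lines. -/
theorem exists_angleProfile_lower_bound {r : ℝ} (hr0 : 0 ≤ r) (hr1 : r < 1) :
    ∃ K : ℝ, 0 ≤ K ∧ ∀ x ∈ Set.Icc (-1 : ℝ) 1, ∀ y ∈ Set.Icc (-1 : ℝ) 1,
      angleProfile r x + angleProfileDeriv r x * (y - x) - K * (y - x) ^ 2 ≤ angleProfile r y := by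
  have hsq : ∀ x ∈ Set.Icc (-1 : ℝ) 1, x ^ 2 ≤ 1 := fun x hx => by nlinarith [hx.1, hx.2]
  obtain ⟨K, hK⟩ := exists_lipschitz_angleProfileDeriv hr0 hr1
  refine ⟨K, K.2, fun x hx y hy => ?_⟩
  -- Mean value inequality for the profile minus its tangent slope: the derivative of this
  -- difference is at most `K * |y - x|` on the segment.
  have key := Convex.norm_image_sub_le_of_norm_hasDerivWithin_le (𝕜 := ℝ)
    (f := fun z => angleProfile r z - angleProfileDeriv r x * z)
    (f' := fun z => angleProfileDeriv r z - angleProfileDeriv r x) (s := Set.uIcc x y) (x := x)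
    (y := y) (C := K * |y - x|)
    (fun z hz => ?_) (fun z hz => ?_) (convex_uIcc x y) Set.left_mem_uIcc Set.right_mem_uIcc
  · rw [Real.norm_eq_abs, Real.norm_eq_abs, mul_assoc, abs_mul_abs_self] at key
    have := (abs_le.1 key).1
    linarith
  · have hz' := (Set.uIcc_subset_Icc hx hy) hz
    have := ((hasDerivAt_angleProfile hr0 hr1 (hsq z hz')).sub
      ((hasDerivAt_id z).const_mul (angleProfileDeriv r x))).hasDerivWithinAt (s := Set.uIcc x y)
    exact this.congr_deriv (by simp)
  · have hz' := (Set.uIcc_subset_Icc hx hy) hz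
    refine (hK.norm_sub_le hz' hx).trans ?_
    gcongr
    rw [Real.norm_eq_abs]
    exact Set.abs_sub_left_of_mem_uIcc hz

/-! ### Eigenframes and their first-order perturbation. -/

/-- An orthonormal family `b` that diagonalizes the compression of `R` to its span, with the
eigenvalues `ν` in increasing order. -/
structure IsEigenframe {E : Type*} [NormedAddCommGroup E] [InnerProductSpace ℂ E] {k : ℕ}
    (R : E ≃ₗᵢ[ℂ] E) (b : Fin k → E) (ν : Fin k → ℝ) : Prop where
  orthonormal : Orthonormal ℂ b
  inner_map : ∀ i j, ⟪b i, R (b j)⟫_ℂ = if i = j then (ν j : ℂ) else 0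
  monotone : Monotone ν

section Eigenframe

variable {E : Type*} [NormedAddCommGroup E] [InnerProductSpace ℂ E] {k : ℕ}
  {R : E ≃ₗᵢ[ℂ] E} {b b' : Fin k → E} {ν ν' : Fin k → ℝ} {U : E →L[ℂ] E}

theorem IsEigenframe.inner_eq (hb : IsEigenframe R b ν) (i j : Fin k) :
    ⟪b i, b j⟫_ℂ = if i = j then 1 else 0 :=
  orthonormal_iff_ite.1 hb.orthonormal i j

theorem IsEigenframe.abs_le_one (hb : IsEigenframe R b ν) (i : Fin k) : |ν i| ≤ 1 := by
  have h := norm_inner_le_norm (𝕜 := ℂ) (b i) (R (b i))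
  rw [hb.inner_map, if_pos rfl, R.norm_map, hb.orthonormal.1 i, Complex.norm_real] at h
  simpa using h

theorem IsEigenframe.mem_Icc (hb : IsEigenframe R b ν) (i : Fin k) : ν i ∈ Set.Icc (-1 : ℝ) 1 :=
  abs_le.1 (hb.abs_le_one i)

theorem IsEigenframe.sq_le_one (hb : IsEigenframe R b ν) (i : Fin k) : ν i ^ 2 ≤ 1 :=
  (sq_le_one_iff_abs_le_one _).2 (hb.abs_le_one i)

/-- The component of `R (b j)` orthogonal to the span of the frame. -/
def normalPart (R : E ≃ₗᵢ[ℂ] E) (b : Fin k → E) (ν : Fin k → ℝ) (j : Fin k) : E :=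
  R (b j) - (ν j : ℂ) • b j

theorem IsEigenframe.inner_normalPart (hb : IsEigenframe R b ν) (i j : Fin k) :
    ⟪b i, normalPart R b ν j⟫_ℂ = 0 := by
  rw [normalPart, inner_sub_right, inner_smul_right, hb.inner_map, hb.inner_eq]
  split_ifs <;> simp

/-- `R` is isometric, so the `R (b j)` are orthonormal, and their components in the span of the
frame are already mutually orthogonal; the remainders must be so too. -/
theorem IsEigenframe.inner_normalPart_normalPart (hb : IsEigenframe R b ν) (i j : Fin k) :
    ⟪normalPart R b ν i, normalPart R b ν j⟫_ℂ = if i = j then ((1 - ν j ^ 2 : ℝ) : ℂ) else 0 := by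
  have h1 : ⟪R (b i), b j⟫_ℂ = if i = j then (ν j : ℂ) else 0 := by
    rw [← inner_conj_symm, hb.inner_map]
    by_cases h : i = j
    · subst h; simp
    · simp [h, Ne.symm h]
  rw [normalPart, inner_sub_left, inner_smul_left, hb.inner_normalPart, normalPart,
    inner_sub_right, inner_smul_right, R.inner_map_map, hb.inner_eq, h1]
  split_ifs <;> push_cast <;> ring

theorem IsEigenframe.norm_normalPart (hb : IsEigenframe R b ν) (j : Fin k) :
    ‖normalPart R b ν j‖ = √(1 - ν j ^ 2) := by
  have h := hb.inner_normalPart_normalPart j j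
  rw [if_pos rfl, inner_self_eq_norm_sq_to_K] at h
  rw [eq_comm, Real.sqrt_eq_iff_eq_sq (by linarith [hb.sq_le_one j]) (norm_nonneg _)]
  have h' : ((‖normalPart R b ν j‖ ^ 2 : ℝ) : ℂ) = ((1 - ν j ^ 2 : ℝ) : ℂ) := by
    rw [← h]; push_cast; rfl
  exact (Complex.ofReal_injective h').symm

theorem sum_inner_smul_of_mem_span (hb : Orthonormal ℂ b) {x : E}
    (hx : x ∈ Submodule.span ℂ (Set.range b)) : ∑ i, ⟪b i, x⟫_ℂ • b i = x := by
  obtain ⟨c, rfl⟩ := (Submodule.mem_span_range_iff_exists_fun ℂ).1 hx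
  exact Finset.sum_congr rfl fun i _ => by rw [hb.inner_right_fintype]

theorem IsEigenframe.inner_map_sum (hb : IsEigenframe R b ν) (c : Fin k → ℂ) (l : Fin k) :
    ⟪b l, R (∑ i, c i • b i)⟫_ℂ = c l * ν l := by
  simp only [map_sum, map_smul, inner_sum, inner_smul_right, hb.inner_map]
  simp

theorem IsEigenframe.inner_map_of_mem_span (hb : IsEigenframe R b ν) {u : E}
    (hu : u ∈ Submodule.span ℂ (Set.range b)) (j : Fin k) :
    ⟪u, R (b j)⟫_ℂ = ν j * ⟪u, b j⟫_ℂ := by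
  obtain ⟨c, rfl⟩ := (Submodule.mem_span_range_iff_exists_fun ℂ).1 hu
  simp only [sum_inner, inner_smul_left, hb.inner_map, hb.inner_eq, Finset.mul_sum]
  exact Finset.sum_congr rfl fun i _ => by split_ifs <;> simp [mul_comm]

theorem norm_sq_sum_smul (hb : Orthonormal ℂ b) (c : Fin k → ℂ) :
    ‖∑ i, c i • b i‖ ^ 2 = ∑ i, ‖c i‖ ^ 2 := by
  apply Complex.ofReal_injective
  push_cast
  refine (inner_self_eq_norm_sq_to_K (𝕜 := ℂ) (∑ i, c i • b i)).symm.trans ?_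
  rw [hb.inner_sum]
  exact Finset.sum_congr rfl fun i _ => by rw [Complex.conj_mul']

theorem map_mem_span_of_span_eq
    (hspan : Submodule.span ℂ (Set.range b') = (Submodule.span ℂ (Set.range b)).map U.toLinearMap)
    (j : Fin k) : U (b j) ∈ Submodule.span ℂ (Set.range b') := by
  rw [hspan]
  exact Submodule.mem_map_of_mem (Submodule.subset_span ⟨j, rfl⟩)

theorem norm_map_of_inner_map_map (hU : ∀ x y, ⟪U x, U y⟫_ℂ = ⟪x, y⟫_ℂ) (x : E) :
    ‖U x‖ = ‖x‖ := by
  rw [@norm_eq_sqrt_re_inner ℂ, hU, ← norm_eq_sqrt_re_inner]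

theorem IsEigenframe.sum_norm_sq_inner_eq_one (hb : IsEigenframe R b ν)
    (hb' : IsEigenframe R b' ν') (hU : ∀ x y, ⟪U x, U y⟫_ℂ = ⟪x, y⟫_ℂ)
    (hspan : Submodule.span ℂ (Set.range b') = (Submodule.span ℂ (Set.range b)).map U.toLinearMap)
    (j : Fin k) : ∑ i, ‖⟪b' i, U (b j)⟫_ℂ‖ ^ 2 = 1 := by
  rw [← norm_sq_sum_smul hb'.orthonormal,
    sum_inner_smul_of_mem_span hb'.orthonormal (map_mem_span_of_span_eq hspan j),
    norm_map_of_inner_map_map hU, hb.orthonormal.1 j, one_pow]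

theorem IsEigenframe.sum_norm_sq_inner_mul (hb' : IsEigenframe R b' ν')
    (hspan : Submodule.span ℂ (Set.range b') = (Submodule.span ℂ (Set.range b)).map U.toLinearMap)
    (j : Fin k) : ∑ i, ‖⟪b' i, U (b j)⟫_ℂ‖ ^ 2 * ν' i = (⟪U (b j), R (U (b j))⟫_ℂ).re := by
  have h := sum_inner_smul_of_mem_span hb'.orthonormal (map_mem_span_of_span_eq hspan j)
  set a := fun i => ⟪b' i, U (b j)⟫_ℂ with ha
  have h2 : ⟪U (b j), R (U (b j))⟫_ℂ = ((∑ i, ‖a i‖ ^ 2 * ν' i : ℝ) : ℂ) := by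
    rw [← h, sum_inner]
    push_cast
    refine Finset.sum_congr rfl fun i _ => ?_
    rw [inner_smul_left, hb'.inner_map_sum (fun i => a i), ← mul_assoc, Complex.conj_mul']
  rw [h2, Complex.ofReal_re]

/-- The left side is the squared residual of `U (b j)` as an approximate eigenvector, with value `ν
j`, of the compression of `R` to the new subspace. It makes the quadratic error in the tangent-line
bound second order, even if the frame `b'` is far from `U b`. -/
theorem IsEigenframe.sum_norm_sq_inner_mul_sq_le (hb : IsEigenframe R b ν)
    (hb' : IsEigenframe R b' ν') (hU : ∀ x y, ⟪U x, U y⟫_ℂ = ⟪x, y⟫_ℂ)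
    (hspan : Submodule.span ℂ (Set.range b') = (Submodule.span ℂ (Set.range b)).map U.toLinearMap)
    (j : Fin k) :
    ∑ i, ‖⟪b' i, U (b j)⟫_ℂ‖ ^ 2 * (ν' i - ν j) ^ 2 ≤ (2 * ‖U - 1‖) ^ 2 := by
  have h := sum_inner_smul_of_mem_span hb'.orthonormal (map_mem_span_of_span_eq hspan j)
  set a := fun i => ⟪b' i, U (b j)⟫_ℂ with ha
  set q := ∑ i, (a i * ((ν' i - ν j : ℝ) : ℂ)) • b' i with hq
  have hqn : ‖q‖ ^ 2 = ∑ i, ‖a i‖ ^ 2 * (ν' i - ν j) ^ 2 := by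
    rw [hq, norm_sq_sum_smul hb'.orthonormal]
    exact Finset.sum_congr rfl fun i _ => by
      rw [norm_mul, mul_pow, Complex.norm_real, Real.norm_eq_abs, sq_abs]
  have hqmem : q ∈ Submodule.span ℂ (Set.range b') :=
    Submodule.sum_mem _ fun i _ => Submodule.smul_mem _ _ (Submodule.subset_span ⟨i, rfl⟩)
  have hqin : ∀ x ∈ Submodule.span ℂ (Set.range b'),
      ⟪x, q⟫_ℂ = ⟪x, R (U (b j))⟫_ℂ - ν j * ⟪x, U (b j)⟫_ℂ := by
    intro x hx
    obtain ⟨c, rfl⟩ := (Submodule.mem_span_range_iff_exists_fun ℂ).1 hx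
    simp only [sum_inner, inner_smul_left, Finset.mul_sum, ← Finset.sum_sub_distrib]
    refine Finset.sum_congr rfl fun i _ => ?_
    have h1 : ⟪b' i, R (U (b j))⟫_ℂ = a i * ν' i := by
      rw [← h]; exact hb'.inner_map_sum (fun i => a i) i
    rw [h1, hq, hb'.orthonormal.inner_right_fintype]
    push_cast; ring
  -- Pulling `q` back to the old subspace allows the exact eigenvalue relation to be subtracted
  -- there; only terms containing `U - 1` survive in `⟪q, q⟫_ℂ`.
  obtain ⟨u, hu, huq⟩ : ∃ u ∈ Submodule.span ℂ (Set.range b), U u = q := by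
    rw [hspan] at hqmem; exact hqmem
  have hun : ‖u‖ = ‖q‖ := by rw [← huq, norm_map_of_inner_map_map hU]
  have hexp : ⟪q, q⟫_ℂ = ⟪U u, R ((U - 1) (b j))⟫_ℂ + ⟪(U - 1) u, R (b j)⟫_ℂ := by
    rw [hqin q hqmem, ← huq, hU, ← hb.inner_map_of_mem_span hu]
    simp only [sub_apply, one_apply_eq_self, map_sub,
      inner_sub_right, inner_sub_left]
    ring
  have hle : ‖q‖ ^ 2 ≤ 2 * ‖U - 1‖ * ‖q‖ := by
    have h1 : ‖⟪q, q⟫_ℂ‖ = ‖q‖ ^ 2 := by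
      rw [inner_self_eq_norm_sq_to_K, norm_pow]; simp
    rw [← h1, hexp]
    refine (norm_add_le _ _).trans ?_
    have h2 := (norm_inner_le_norm (𝕜 := ℂ) (U u) (R ((U - 1) (b j))))
    have h3 := (norm_inner_le_norm (𝕜 := ℂ) ((U - 1) u) (R (b j)))
    rw [R.norm_map, norm_map_of_inner_map_map hU, hun] at h2
    rw [R.norm_map, hb.orthonormal.1 j, mul_one] at h3
    have h4 := (U - 1).le_opNorm (b j)
    rw [hb.orthonormal.1 j, mul_one] at h4
    have h5 := (U - 1).le_opNorm u
    rw [hun] at h5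
    nlinarith [norm_nonneg q]
  rw [← hqn]
  have h6 : ‖q‖ ≤ 2 * ‖U - 1‖ := by
    by_contra hcon
    push Not at hcon
    nlinarith [norm_nonneg (U - 1)]
  gcongr

/-- First-order expansion of the diagonal entries of the compression of `R` along `U ≈ 1 + s G`
with `G` skew-adjoint. -/
theorem IsEigenframe.abs_re_inner_map_sub_le (hb : IsEigenframe R b ν)
    (hR : ∀ x y, ⟪R x, y⟫_ℂ = ⟪x, R y⟫_ℂ) {G : E →L[ℂ] E} (hG : ∀ x, (⟪x, G x⟫_ℂ).re = 0)
    (s : ℝ) (j : Fin k) :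
    |(⟪U (b j), R (U (b j))⟫_ℂ).re - ν j - s * (2 * (⟪normalPart R b ν j, G (b j)⟫_ℂ).re)| ≤
      2 * ‖U - 1 - (s : ℂ) • G‖ + ‖U - 1‖ ^ 2 := by
  set D := (U - 1) (b j) with hD
  set e := (U - 1 - (s : ℂ) • G) (b j) with he
  have hUb : U (b j) = b j + D := by simp [hD]
  have hDe : D = e + (s : ℂ) • G (b j) := by simp [hD, he]
  have h1 : (⟪U (b j), R (U (b j))⟫_ℂ).re = ν j + 2 * (⟪R (b j), D⟫_ℂ).re + (⟪D, R D⟫_ℂ).re := by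
    rw [hUb, map_add, inner_add_left, inner_add_right, inner_add_right, hb.inner_map, if_pos rfl,
      ← hR (b j) D, ← inner_conj_symm D (R (b j))]
    simp only [Complex.add_re, Complex.ofReal_re, Complex.conj_re]
    ring
  have h2 : (⟪R (b j), D⟫_ℂ).re = (⟪R (b j), e⟫_ℂ).re +
      s * (⟪normalPart R b ν j, G (b j)⟫_ℂ).re := by
    have h3 : R (b j) = normalPart R b ν j + (ν j : ℂ) • b j := by simp [normalPart]
    -- The tangential part `ν j • b j` drops out, because `ν j` is real and `⟪b j, G (b j)⟫_ℂ` is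
    -- purely imaginary.
    have h4 : (⟪R (b j), G (b j)⟫_ℂ).re = (⟪normalPart R b ν j, G (b j)⟫_ℂ).re := by
      rw [h3, inner_add_left, inner_smul_left, Complex.add_re, Complex.conj_ofReal,
        Complex.re_ofReal_mul, hG, mul_zero, add_zero]
    rw [hDe, inner_add_right, inner_smul_right, Complex.add_re, Complex.re_ofReal_mul, h4]
  have h5 : |(⟪R (b j), e⟫_ℂ).re| ≤ ‖U - 1 - (s : ℂ) • G‖ := by
    refine (Complex.abs_re_le_norm _).trans ((norm_inner_le_norm _ _).trans ?_)
    rw [R.norm_map, hb.orthonormal.1 j, one_mul]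
    have h7 := (U - 1 - (s : ℂ) • G).le_opNorm (b j)
    rwa [hb.orthonormal.1 j, mul_one] at h7
  have h6 : |(⟪D, R D⟫_ℂ).re| ≤ ‖U - 1‖ ^ 2 := by
    refine (Complex.abs_re_le_norm _).trans ((norm_inner_le_norm _ _).trans ?_)
    have h7 := (U - 1).le_opNorm (b j)
    rw [hb.orthonormal.1 j, mul_one] at h7
    rw [R.norm_map, sq]
    gcongr
  rw [h1, h2]
  rw [abs_le] at *
  constructor <;> linarith [h5.1, h5.2, h6.1, h6.2]

end Eigenframe

/-! ### Competitors in the discrepancy norm and the one-step estimate. -/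

theorem le_discrepancyNorm {n m : ℕ} (A : Matrix (Fin n) (Fin n) ℂ)
    {x y : Fin m → EuclideanSpace ℂ (Fin n)} (hx : Orthonormal ℂ x) (hy : Orthonormal ℂ y)
    (hxy : ∑ j, ⟪x j, y j⟫_ℂ = 0) :
    ‖∑ j, ⟪Matrix.toEuclideanLin A (x j), y j⟫_ℂ‖ ≤ discrepancyNorm A m := by
  refine le_csSup ⟨∑ _j : Fin m, ‖Matrix.toEuclideanCLM (n := Fin n) (𝕜 := ℂ) A‖, ?_⟩
    ⟨x, y, hx, hy, hxy, rfl⟩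
  rintro _ ⟨x, y, hx, hy, -, rfl⟩
  refine norm_sum_le_of_le _ fun j _ => (norm_inner_le_norm _ _).trans ?_
  rw [hy.1 j, mul_one]
  have := (Matrix.toEuclideanCLM (n := Fin n) (𝕜 := ℂ) A).le_opNorm (x j)
  rwa [hx.1 j, mul_one] at this

/-- If `b` is orthonormal and the `v j` are pairwise orthogonal and orthogonal to `b`, then the
nonzero `v j` can be normalized and completed so as to compete in the discrepancy norm. -/
theorem sum_norm_inner_le_discrepancyNorm {n k : ℕ} (A : Matrix (Fin n) (Fin n) ℂ)
    {b v : Fin k → EuclideanSpace ℂ (Fin n)} (hb : Orthonormal ℂ b)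
    (hbv : ∀ i j, ⟪b i, v j⟫_ℂ = 0) (hv : ∀ i j, i ≠ j → ⟪v i, v j⟫_ℂ = 0) (s : Finset (Fin k)) :
    ∑ j ∈ s, ‖⟪Matrix.toEuclideanLin A (b j), ((‖v j‖⁻¹ : ℝ) : ℂ) • v j⟫_ℂ‖ ≤
      discrepancyNorm A (min s.card (n - k)) := by
  classical
  set z := fun j => ((‖v j‖⁻¹ : ℝ) : ℂ) • v j with hz
  have hz1 : ∀ j, z j ≠ 0 → ‖z j‖ = 1 := by
    intro j hj
    have hj' : v j ≠ 0 := fun h => hj (by simp [hz, h])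
    simp [hz, norm_smul, hj']
  have hbz : ∀ i j, ⟪b i, z j⟫_ℂ = 0 := fun i j => by rw [hz, inner_smul_right, hbv, mul_zero]
  have hzb : ∀ i j, ⟪z i, b j⟫_ℂ = 0 := fun i j => inner_eq_zero_symm.1 (hbz j i)
  have hzz : ∀ i j, i ≠ j → ⟪z i, z j⟫_ℂ = 0 := fun i j h => by
    simp only [hz]; rw [inner_smul_right, inner_smul_left, hv i j h, mul_zero, mul_zero]
  set J₀ := s.filter fun j => z j ≠ 0 with hJ₀
  have hkJ : k + J₀.card ≤ n := by
    have ho : Orthonormal ℂ (Sum.elim b fun j : J₀ => z j) := by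
      constructor
      · rintro (i | ⟨j, hj⟩)
        · exact hb.1 i
        · exact hz1 j (Finset.mem_filter.1 hj).2
      · rintro (i | ⟨i, hi⟩) (j | ⟨j, hj⟩) h
        · exact hb.2 (fun h' => h (by rw [h']))
        · exact hbz i j
        · exact hzb i j
        · exact hzz i j fun h' => h (by subst h'; rfl)
    simpa using ho.linearIndependent.fintype_card_le_finrank
  -- The norm requires exactly `min s.card (n - k)` pairs, so the indices with nonzero `z j` are
  -- padded; this avoids any monotonicity of the norm in its index.
  obtain ⟨J, hJ0, hJs, hJc⟩ := Finset.exists_subsuperset_card_eq (s := J₀) (t := s)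
    (n := min s.card (n - k)) (Finset.filter_subset _ _)
    (le_min (Finset.card_le_card (Finset.filter_subset _ _)) (by omega)) (min_le_left _ _)
  -- The index type has `n` elements; zero entries are placeholders that the extension to an
  -- orthonormal basis is free to fill.
  set w : Fin k ⊕ (J ⊕ Fin (n - k - J.card)) → EuclideanSpace ℂ (Fin n) :=
    Sum.elim b (Sum.elim (fun j => z j) 0) with hw
  have hwo : Orthonormal ℂ (({i | w i ≠ 0} : Set _).domRestrict w) := by
    constructor
    · rintro ⟨i | j | l, hi⟩
      · exact hb.1 i
      · exact hz1 j hi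
      · exact absurd rfl hi
    · rintro ⟨i | i | i, hi⟩ ⟨j | j | j, hj⟩ h
      · exact hb.2 (fun h' => h (by subst h'; rfl))
      · exact hbz i j
      · exact absurd rfl hj
      · exact hzb i j
      · exact hzz i j fun h' => h (by
          have h'' : i = j := Subtype.ext h'
          subst h''; rfl)
      · exact absurd rfl hj
      all_goals exact absurd rfl hi
  obtain ⟨B, hB⟩ := hwo.exists_orthonormalBasis_extension_of_card_eq (by
    simp only [finrank_euclideanSpace, Fintype.card_fin, Fintype.card_sum, Fintype.card_coe]
    omega)
  have hBb : ∀ i, B (Sum.inl i) = b i := fun i => hB _ (hb.ne_zero i)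
  set e := (J.equivFinOfCardEq hJc).symm with he
  -- Rotating each `y` by a phase turns the modulus of the sum into the sum of the moduli.
  have hphase : ∀ a : ℂ, ∃ c : ℂ, ‖c‖ = 1 ∧ c * a = ‖a‖ := by
    intro a
    by_cases ha : a = 0
    · exact ⟨1, by simp, by simp [ha]⟩
    · refine ⟨‖a‖ / a, by simp [ha], by field_simp⟩
  choose φ hφ1 hφ2 using hphase
  set t : Fin (min s.card (n - k)) → ℂ := fun l =>
    ⟪Matrix.toEuclideanLin A (b (e l)), B (Sum.inr (Sum.inl (e l)))⟫_ℂ with ht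
  have hx : Orthonormal ℂ fun l => b (e l) :=
    hb.comp _ (Subtype.val_injective.comp e.injective)
  have hy : Orthonormal ℂ fun l => φ (t l) • B (Sum.inr (Sum.inl (e l))) := by
    constructor
    · intro l
      rw [norm_smul, hφ1, B.orthonormal.1, mul_one]
    · intro l l' h
      rw [inner_smul_left, inner_smul_right, B.orthonormal.2 (fun h' => h ?_), mul_zero, mul_zero]
      exact e.injective (Sum.inl_injective (Sum.inr_injective h'))
  have hxy : ∑ l, ⟪b (e l), φ (t l) • B (Sum.inr (Sum.inl (e l)))⟫_ℂ = 0 := by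
    refine Finset.sum_eq_zero fun l _ => ?_
    rw [inner_smul_right, ← hBb, B.orthonormal.2 Sum.inl_ne_inr, mul_zero]
  have key := le_discrepancyNorm A hx hy hxy
  have hsum : ∑ l, ⟪Matrix.toEuclideanLin A (b (e l)), φ (t l) • B (Sum.inr (Sum.inl (e l)))⟫_ℂ =
      ((∑ l, ‖t l‖ : ℝ) : ℂ) := by
    push_cast
    exact Finset.sum_congr rfl fun l _ => by rw [inner_smul_right, hφ2]
  rw [hsum, Complex.norm_real, Real.norm_of_nonneg (Finset.sum_nonneg fun _ _ => norm_nonneg _)]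
    at key
  refine le_trans ?_ key
  have h1 : ∑ l, ‖t l‖ = ∑ j : J, ‖⟪Matrix.toEuclideanLin A (b j), B (Sum.inr (Sum.inl j))⟫_ℂ‖ :=
    Equiv.sum_comp e fun j : J => ‖⟪Matrix.toEuclideanLin A (b j), B (Sum.inr (Sum.inl j))⟫_ℂ‖
  have h2 : ∑ j ∈ s, ‖⟪Matrix.toEuclideanLin A (b j), z j⟫_ℂ‖ =
      ∑ j : J, ‖⟪Matrix.toEuclideanLin A (b j), z j⟫_ℂ‖ := by
    rw [Finset.sum_coe_sort J fun j => ‖⟪Matrix.toEuclideanLin A (b j), z j⟫_ℂ‖]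
    refine (Finset.sum_subset hJs fun j hj hjJ => ?_).symm
    have : z j = 0 := by
      by_contra hne
      exact hjJ (hJ0 (Finset.mem_filter.2 ⟨hj, hne⟩))
    rw [this, inner_zero_right, norm_zero]
  rw [h1, h2]
  refine Finset.sum_le_sum fun j _ => ?_
  by_cases hj : z j = 0
  · rw [hj, inner_zero_right, norm_zero]; exact norm_nonneg _
  · rw [hB (Sum.inr (Sum.inl j)) hj]; rfl

/-- One step of the flow changes the sum of the `m` largest regularized angles by at most
`s * discrepancyNorm X (min m (n - k))`, up to second order errors. -/
theorem IsEigenframe.sum_angleProfile_le {n k m : ℕ} (hm : m ≤ k) {r K : ℝ} (hr0 : 0 ≤ r)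
    (hr1 : r < 1) (hK0 : 0 ≤ K)
    (hK : ∀ x ∈ Set.Icc (-1 : ℝ) 1, ∀ y ∈ Set.Icc (-1 : ℝ) 1,
      angleProfile r x + angleProfileDeriv r x * (y - x) - K * (y - x) ^ 2 ≤ angleProfile r y)
    {M : ℝ} (hM : ∀ x ∈ Set.Icc (-1 : ℝ) 1, |angleProfileDeriv r x| ≤ M)
    {R : EuclideanSpace ℂ (Fin n) ≃ₗᵢ[ℂ] EuclideanSpace ℂ (Fin n)}
    (hR : ∀ x y, ⟪R x, y⟫_ℂ = ⟪x, R y⟫_ℂ)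
    {b b' : Fin k → EuclideanSpace ℂ (Fin n)} {ν ν' : Fin k → ℝ}
    (hb : IsEigenframe R b ν) (hb' : IsEigenframe R b' ν')
    {U : EuclideanSpace ℂ (Fin n) →L[ℂ] EuclideanSpace ℂ (Fin n)}
    (hU : ∀ x y, ⟪U x, U y⟫_ℂ = ⟪x, y⟫_ℂ)
    (hspan : Submodule.span ℂ (Set.range b') = (Submodule.span ℂ (Set.range b)).map U.toLinearMap)
    (A : Matrix (Fin n) (Fin n) ℂ)
    {G : EuclideanSpace ℂ (Fin n) →L[ℂ] EuclideanSpace ℂ (Fin n)}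
    (hG : ∀ x, (⟪x, G x⟫_ℂ).re = 0)
    (hGA : ∀ x y, ‖⟪x, G y⟫_ℂ‖ = ‖⟪Matrix.toEuclideanLin A y, x⟫_ℂ‖) {s : ℝ} (hs : 0 ≤ s) :
    ∑ j ∈ Finset.univ.filter (fun j : Fin k => (j : ℕ) < m), angleProfile r (ν j) ≤
      ∑ j ∈ Finset.univ.filter (fun j : Fin k => (j : ℕ) < m), angleProfile r (ν' j)
        + s * discrepancyNorm A (min m (n - k))
        + m * (M * (2 * ‖U - 1 - (s : ℂ) • G‖ + ‖U - 1‖ ^ 2) + K * (2 * ‖U - 1‖) ^ 2) := by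
  set s₀ := Finset.univ.filter (fun j : Fin k => (j : ℕ) < m) with hs₀
  have hcard : s₀.card = m := card_filter_val_lt hm
  set a : Fin k → Fin k → ℝ := fun i j => ‖⟪b' i, U (b j)⟫_ℂ‖ ^ 2 with ha
  set err := M * (2 * ‖U - 1 - (s : ℂ) • G‖ + ‖U - 1‖ ^ 2) + K * (2 * ‖U - 1‖) ^ 2 with herr
  set g : Fin k → ℝ := fun j =>
    2 * angleProfileDeriv r (ν j) * (⟪normalPart R b ν j, G (b j)⟫_ℂ).re with hg
  -- Average the tangent-line bound at `ν j` over the weights `a i j`, which sum to one over `i`;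
  -- the mean of the `ν' i` is the diagonal entry of `R` at `U (b j)`.
  have hpoint : ∀ j, angleProfile r (ν j) ≤ ∑ i, a i j * angleProfile r (ν' i) - s * g j + err := by
    intro j
    have h1 : ∑ i, a i j * (angleProfile r (ν j) + angleProfileDeriv r (ν j) * (ν' i - ν j)
        - K * (ν' i - ν j) ^ 2) ≤ ∑ i, a i j * angleProfile r (ν' i) :=
      Finset.sum_le_sum fun i _ => mul_le_mul_of_nonneg_left
        (hK _ (hb.mem_Icc j) _ (hb'.mem_Icc i)) (sq_nonneg _)
    have h2 : ∑ i, a i j * (angleProfile r (ν j) + angleProfileDeriv r (ν j) * (ν' i - ν j)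
        - K * (ν' i - ν j) ^ 2) = (∑ i, a i j) * (angleProfile r (ν j)
          - angleProfileDeriv r (ν j) * ν j) + angleProfileDeriv r (ν j) * ∑ i, a i j * ν' i
          - K * ∑ i, a i j * (ν' i - ν j) ^ 2 := by
      rw [Finset.sum_mul, Finset.mul_sum, Finset.mul_sum, ← Finset.sum_add_distrib,
        ← Finset.sum_sub_distrib]
      exact Finset.sum_congr rfl fun i _ => by ring
    have h3 := hb.sum_norm_sq_inner_eq_one hb' hU hspan j
    have h4 := hb'.sum_norm_sq_inner_mul hspan j
    have h5 := hb.sum_norm_sq_inner_mul_sq_le hb' hU hspan j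
    have h6 := hb.abs_re_inner_map_sub_le (U := U) hR hG s j
    rw [h2] at h1
    simp only [ha] at h1
    rw [h3, h4] at h1
    set c := (⟪U (b j), R (U (b j))⟫_ℂ).re with hc
    have h7 : |angleProfileDeriv r (ν j) * (c - ν j
        - s * (2 * (⟪normalPart R b ν j, G (b j)⟫_ℂ).re))| ≤
        M * (2 * ‖U - 1 - (s : ℂ) • G‖ + ‖U - 1‖ ^ 2) := by
      rw [abs_mul]
      exact mul_le_mul (hM _ (hb.mem_Icc j)) h6 (abs_nonneg _)
        ((abs_nonneg _).trans (hM _ (hb.mem_Icc j)))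
    have h8 := mul_le_mul_of_nonneg_left h5 hK0
    have h9 := (abs_le.1 h7).1
    simp only [herr, hg]
    linarith
  -- The weight of each `i` is at most one by Bessel, and the total mass is `m`.
  have hweights : ∑ i, (∑ j ∈ s₀, a i j) * angleProfile r (ν' i) ≤
      ∑ j ∈ s₀, angleProfile r (ν' j) := by
    refine sum_mul_le_sum_of_antitone hm
      ((antitone_angleProfile hr0).comp_monotone hb'.monotone)
      (fun i => Finset.sum_nonneg fun j _ => sq_nonneg _) (fun i => ?_) ?_
    · have hUb : Orthonormal ℂ fun j => U (b j) :=
        orthonormal_iff_ite.2 fun i j => by rw [hU, hb.inner_eq]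
      have := hUb.sum_inner_products_le (b' i) (s := s₀)
      rw [hb'.orthonormal.1 i, one_pow] at this
      refine le_trans (le_of_eq (Finset.sum_congr rfl fun j _ => ?_)) this
      rw [ha, norm_inner_symm]
    · rw [Finset.sum_comm, Finset.sum_congr rfl fun j _ =>
        hb.sum_norm_sq_inner_eq_one hb' hU hspan j]
      simp [hcard]
  have hD : -∑ j ∈ s₀, g j ≤ discrepancyNorm A (min m (n - k)) := by
    have h1 := sum_norm_inner_le_discrepancyNorm A hb.orthonormal hb.inner_normalPart
      (fun i j h => by rw [hb.inner_normalPart_normalPart, if_neg h]) s₀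
    rw [hcard] at h1
    refine le_trans ?_ h1
    rw [← Finset.sum_neg_distrib]
    refine Finset.sum_le_sum fun j _ => (neg_le_abs _).trans ?_
    rw [hg, abs_mul]
    refine (mul_le_mul_of_nonneg_left (Complex.abs_re_le_norm _) (abs_nonneg _)).trans ?_
    rw [hGA, inner_smul_right, norm_mul, Complex.norm_real, norm_inv, norm_norm]
    have h2 := abs_two_mul_angleProfileDeriv_le hr0 hr1 (hb.sq_le_one j)
    rw [← hb.norm_normalPart] at h2
    -- A vanishing normal part corresponds to `ν j = ±1`; both sides are then zero and no division
    -- is involved.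
    obtain h0 | h0 := (norm_nonneg (normalPart R b ν j)).eq_or_lt
    · have : normalPart R b ν j = 0 := norm_eq_zero.1 h0.symm
      simp [this]
    · have h3 : |2 * angleProfileDeriv r (ν j)| ≤ ‖normalPart R b ν j‖⁻¹ := by
        rwa [← one_div, le_div_iff₀ h0]
      exact mul_le_mul_of_nonneg_right h3 (norm_nonneg _)
  have htot : ∑ j ∈ s₀, angleProfile r (ν j) ≤
      ∑ i, (∑ j ∈ s₀, a i j) * angleProfile r (ν' i) - s * ∑ j ∈ s₀, g j + m * err := by
    refine (Finset.sum_le_sum fun j _ => hpoint j).trans (le_of_eq ?_)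
    rw [Finset.sum_add_distrib, Finset.sum_sub_distrib, Finset.sum_comm, Finset.sum_const, hcard,
      nsmul_eq_mul, Finset.mul_sum]
    simp only [Finset.sum_mul]
  have := mul_le_mul_of_nonneg_left hD hs
  linarith

/-! ### Principal angles as eigenvalues of a compressed reflection. -/

/-- The `i`-th cosine of the principal angles of `S` and `T`, in decreasing order. -/
def principalCosine {n : ℕ} (S T : Submodule ℂ (EuclideanSpace ℂ (Fin n))) (i : ℕ) : ℝ :=
  LinearMap.singularValues (𝕜 := ℂ) (E := T) (F := S)
    (S.orthogonalProjectionOnto ∘L T.subtypeL).toLinearMap i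

/-- The cosines of twice the principal angles of `S` and `T`, in increasing order. -/
def doubleCosine {n : ℕ} (k : ℕ) (S T : Submodule ℂ (EuclideanSpace ℂ (Fin n))) (i : Fin k) : ℝ :=
  2 * principalCosine S T i.rev ^ 2 - 1

theorem exists_orthonormalBasis_inner_map_eq {E F : Type*} [NormedAddCommGroup E]
    [InnerProductSpace ℂ E] [FiniteDimensional ℂ E] [NormedAddCommGroup F] [InnerProductSpace ℂ F]
    [FiniteDimensional ℂ F] {k : ℕ} (A : E →ₗ[ℂ] F) (hE : Module.finrank ℂ E = k) :
    ∃ e : OrthonormalBasis (Fin k) ℂ E, ∀ i j,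
      ⟪A (e i), A (e j)⟫_ℂ = if i = j then ((A.singularValues j ^ 2 : ℝ) : ℂ) else 0 := by
  set e := A.isSymmetric_adjoint_comp_self.eigenvectorBasis hE with he
  refine ⟨e, fun i j => ?_⟩
  rw [← LinearMap.adjoint_inner_right, ← LinearMap.comp_apply, he,
    LinearMap.IsSymmetric.apply_eigenvectorBasis, inner_smul_right, ← he,
    orthonormal_iff_ite.1 e.orthonormal, A.sq_singularValues_fin hE]
  split_ifs <;> simp

section Frames

variable {n k : ℕ} {S T : Submodule ℂ (EuclideanSpace ℂ (Fin n))}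

theorem principalCosine_nonneg (i : ℕ) : 0 ≤ principalCosine S T i :=
  LinearMap.singularValues_nonneg _ _

theorem antitone_principalCosine : Antitone (principalCosine S T) :=
  LinearMap.singularValues_antitone _

theorem inner_reflection_left (x y : EuclideanSpace ℂ (Fin n)) :
    ⟪S.reflection x, y⟫_ℂ = ⟪x, S.reflection y⟫_ℂ := by
  rw [← S.reflection.inner_map_map, Submodule.reflection_reflection]

/-- Right singular vectors of the projection from `T` to `S` diagonalize the compression of `P`,
hence of `2P - 1`. Reversing their order makes the eigenvalues increase. -/
theorem exists_isEigenframe (hT : Module.finrank ℂ T = k) :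
    ∃ b : Fin k → EuclideanSpace ℂ (Fin n), IsEigenframe S.reflection b (doubleCosine k S T) ∧
      Submodule.span ℂ (Set.range b) = T := by
  obtain ⟨e, he⟩ := exists_orthonormalBasis_inner_map_eq (E := T) (F := S)
    (S.orthogonalProjectionOnto ∘L T.subtypeL).toLinearMap hT
  have hee : ∀ i j, ⟪e i, e j⟫_ℂ = if i = j then 1 else 0 := orthonormal_iff_ite.1 e.orthonormal
  have hproj : ∀ i j, ⟪(e i : EuclideanSpace ℂ (Fin n)), S.starProjection (e j)⟫_ℂ =
      if i = j then ((principalCosine S T j ^ 2 : ℝ) : ℂ) else 0 := by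
    intro i j
    refine Eq.trans ?_ (he i j)
    exact (Submodule.inner_orthogonalProjectionOnto_eq_of_mem_right (K := S)
      (S.orthogonalProjectionOnto (e j)) (e i : EuclideanSpace ℂ (Fin n))).symm
  refine ⟨fun i => (e i.rev : EuclideanSpace ℂ (Fin n)), ⟨?_, fun i j => ?_, ?_⟩, ?_⟩
  · exact (e.orthonormal.comp_linearIsometry T.subtypeₗᵢ).comp _ Fin.rev_injective
  · have h2 : ⟪(e i.rev : EuclideanSpace ℂ (Fin n)), (e j.rev : EuclideanSpace ℂ (Fin n))⟫_ℂ =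
        if i = j then 1 else 0 := by
      rw [← Submodule.coe_inner, hee]; simp only [Fin.rev_inj]
    rw [Submodule.reflection_apply, inner_sub_right, two_smul, inner_add_right, hproj, h2]
    simp only [Fin.rev_inj, doubleCosine]
    split_ifs
    · push_cast; ring
    · simp
  · intro i j hij
    have h3 : principalCosine S T i.rev ≤ principalCosine S T j.rev :=
      antitone_principalCosine (Fin.val_fin_le.2 (Fin.rev_le_rev.2 hij))
    have h4 := pow_le_pow_left₀ (principalCosine_nonneg _) h3 2
    simp only [doubleCosine]; linarith
  · have h5 : Set.range (fun i : Fin k => (e i.rev : EuclideanSpace ℂ (Fin n))) =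
        T.subtype '' Set.range e := by
      rw [← Set.range_comp]
      exact Fin.revPerm.surjective.range_comp fun i => T.subtype (e i)
    rw [h5, Submodule.span_image, ← e.coe_toBasis, e.toBasis.span_eq, Submodule.map_top,
      Submodule.range_subtype]

theorem doubleCosine_self (hS : Module.finrank ℂ S = k) (i : Fin k) : doubleCosine k S S i = 1 := by
  obtain ⟨b, hb, hspan⟩ := exists_isEigenframe (S := S) hS
  have hmem : b i ∈ S := by
    have := Submodule.subset_span (R := ℂ) (Set.mem_range_self (f := b) i)
    rwa [hspan] at this
  have h := hb.inner_map i i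
  rw [Submodule.reflection_mem_subspace_eq_self hmem, hb.inner_eq, if_pos rfl, if_pos rfl] at h
  exact_mod_cast h.symm

end Frames

/-! ### The unitary flow generated by a skew-adjoint operator. -/

theorem hasDerivAt_exp_smul_zero {𝔸 : Type*} [NormedRing 𝔸] [NormedAlgebra ℂ 𝔸] [CompleteSpace 𝔸]
    (G : 𝔸) : HasDerivAt (fun z : ℂ => NormedSpace.exp (z • G)) G 0 := by
  have h := hasDerivAt_exp_smul_const (𝕂 := ℂ) G 0
  rwa [zero_smul, NormedSpace.exp_zero, one_mul] at h

open scoped Matrix.Norms.L2Operator in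
theorem toEuclideanCLM_exp {n : ℕ} (A : Matrix (Fin n) (Fin n) ℂ) :
    Matrix.toEuclideanCLM (n := Fin n) (𝕜 := ℂ) (NormedSpace.exp A) =
      NormedSpace.exp (Matrix.toEuclideanCLM (n := Fin n) (𝕜 := ℂ) A) := by
  have h : Continuous (Matrix.toEuclideanCLM (n := Fin n) (𝕜 := ℂ)) :=
    LinearMap.continuous_of_finiteDimensional
      (Matrix.toEuclideanCLM (n := Fin n) (𝕜 := ℂ)).toAlgEquiv.toLinearMap
  let : NormedAlgebra ℚ (Matrix (Fin n) (Fin n) ℂ) := NormedAlgebra.restrictScalars ℚ ℂ _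
  let : NormedAlgebra ℚ (EuclideanSpace ℂ (Fin n) →L[ℂ] EuclideanSpace ℂ (Fin n)) :=
    NormedAlgebra.restrictScalars ℚ ℂ _
  exact NormedSpace.map_exp _ h A

section Skew

variable {n : ℕ} {G : EuclideanSpace ℂ (Fin n) →L[ℂ] EuclideanSpace ℂ (Fin n)}

theorem inner_exp_exp_of_mem_skewAdjoint (hG : G ∈ skewAdjoint _) (x y : EuclideanSpace ℂ (Fin n)) :
    ⟪NormedSpace.exp G x, NormedSpace.exp G y⟫_ℂ = ⟪x, y⟫_ℂ := by
  let : NormedAlgebra ℚ (EuclideanSpace ℂ (Fin n) →L[ℂ] EuclideanSpace ℂ (Fin n)) :=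
    NormedAlgebra.restrictScalars ℚ ℂ _
  have := NormedSpace.exp_mem_unitary_of_mem_skewAdjoint hG
  rw [← ContinuousLinearMap.adjoint_inner_right, ← ContinuousLinearMap.star_eq_adjoint,
    ← mul_apply_eq_comp, Unitary.star_mul_self_of_mem this, one_apply_eq_self]

theorem ofReal_smul_mem_skewAdjoint (hG : G ∈ skewAdjoint _) (s : ℝ) :
    (s : ℂ) • G ∈ skewAdjoint (EuclideanSpace ℂ (Fin n) →L[ℂ] EuclideanSpace ℂ (Fin n)) := by
  rw [skewAdjoint.mem_iff, star_smul, skewAdjoint.mem_iff.1 hG, smul_neg,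
    show star (s : ℂ) = s from Complex.conj_ofReal s]

theorem re_inner_apply_eq_zero_of_mem_skewAdjoint (hG : G ∈ skewAdjoint _)
    (x : EuclideanSpace ℂ (Fin n)) : (⟪x, G x⟫_ℂ).re = 0 := by
  have h : ⟪x, G x⟫_ℂ = -⟪G x, x⟫_ℂ := by
    rw [← ContinuousLinearMap.adjoint_inner_left, ← ContinuousLinearMap.star_eq_adjoint,
      skewAdjoint.mem_iff.1 hG, neg_apply, inner_neg_left]
  rw [← inner_conj_symm (G x)] at h
  have := congrArg Complex.re h
  rw [Complex.neg_re, Complex.conj_re] at this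
  linarith

theorem exp_smul_mul_exp_smul (G : EuclideanSpace ℂ (Fin n) →L[ℂ] EuclideanSpace ℂ (Fin n))
    (s t : ℝ) : NormedSpace.exp ((s : ℂ) • G) * NormedSpace.exp ((t : ℂ) • G) =
      NormedSpace.exp (((s + t : ℝ) : ℂ) • G) := by
  let : NormedAlgebra ℚ (EuclideanSpace ℂ (Fin n) →L[ℂ] EuclideanSpace ℂ (Fin n)) :=
    NormedAlgebra.restrictScalars ℚ ℂ _
  rw [← NormedSpace.exp_add_of_commute (((Commute.refl G).smul_left _).smul_right _),
    Complex.ofReal_add, add_smul (s : ℂ) (t : ℂ) G]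

/-- The second order error of one step of length `s` of the flow is `o(s)`. -/
theorem tendsto_flow_error (G : EuclideanSpace ℂ (Fin n) →L[ℂ] EuclideanSpace ℂ (Fin n))
    (M K : ℝ) :
    Filter.Tendsto (fun N : ℕ => ((N : ℝ) + 1) *
      (M * (2 * ‖NormedSpace.exp (((1 / ((N : ℝ) + 1) : ℝ) : ℂ) • G) - 1
          - ((1 / ((N : ℝ) + 1) : ℝ) : ℂ) • G‖
        + ‖NormedSpace.exp (((1 / ((N : ℝ) + 1) : ℝ) : ℂ) • G) - 1‖ ^ 2)
        + K * (2 * ‖NormedSpace.exp (((1 / ((N : ℝ) + 1) : ℝ) : ℂ) • G) - 1‖) ^ 2))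
      Filter.atTop (nhds 0) := by
  set s : ℕ → ℂ := fun N => ((1 / ((N : ℝ) + 1) : ℝ) : ℂ) with hs
  have hs0 : Filter.Tendsto s Filter.atTop (nhds 0) := by
    have := (Complex.continuous_ofReal.tendsto 0).comp tendsto_one_div_add_atTop_nhds_zero_nat
    rwa [Complex.ofReal_zero] at this
  have hsn : ∀ N : ℕ, ‖s N‖⁻¹ = (N : ℝ) + 1 := fun N => by
    have : (0 : ℝ) < 1 / ((N : ℝ) + 1) := by positivity
    rw [hs, Complex.norm_real, Real.norm_of_nonneg this.le, one_div, inv_inv]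
  have hder := hasDerivAt_exp_smul_zero G
  have he0 : NormedSpace.exp ((0 : ℂ) • G) = 1 := by
    rw [zero_smul ℂ G, NormedSpace.exp_zero]
  have h1 : Filter.Tendsto (fun N => ‖s N‖⁻¹ * ‖NormedSpace.exp (s N • G) - 1 - s N • G‖)
      Filter.atTop (nhds 0) := by
    have := (hasDerivAt_iff_tendsto.1 hder).comp hs0
    simpa only [Function.comp_def, sub_zero, he0] using this
  have h2 : Filter.Tendsto (fun N => ‖NormedSpace.exp (s N • G) - 1‖) Filter.atTop (nhds 0) := by
    have := ((hder.continuousAt.tendsto.comp hs0).sub_const 1).norm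
    simpa only [Function.comp_def, he0, sub_self, norm_zero] using this
  -- One factor of the square, divided by `‖s N‖`, stays bounded by `‖G‖ + o(1)`, while the other
  -- tends to zero.
  have h3 : Filter.Tendsto (fun N => ‖s N‖⁻¹ * ‖NormedSpace.exp (s N • G) - 1‖ ^ 2)
      Filter.atTop (nhds 0) := by
    have h4 := (h1.add_const ‖G‖).mul h2
    rw [mul_zero] at h4
    refine squeeze_zero (fun N => by positivity) (fun N => ?_) h4
    have hpos : 0 < ‖s N‖⁻¹ := by rw [hsn]; positivity
    have h5 : ‖NormedSpace.exp (s N • G) - 1‖ ≤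
        ‖NormedSpace.exp (s N • G) - 1 - s N • G‖ + ‖s N‖ * ‖G‖ := by
      rw [← norm_smul]
      simpa using norm_add_le (NormedSpace.exp (s N • G) - 1 - s N • G) (s N • G)
    have h6 : ‖s N‖⁻¹ * ‖NormedSpace.exp (s N • G) - 1‖ ≤
        ‖s N‖⁻¹ * ‖NormedSpace.exp (s N • G) - 1 - s N • G‖ + ‖G‖ := by
      refine (mul_le_mul_of_nonneg_left h5 hpos.le).trans (le_of_eq ?_)
      rw [mul_add, ← mul_assoc, inv_mul_cancel₀ (inv_pos.1 hpos).ne', one_mul]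
    rw [sq, ← mul_assoc]
    exact mul_le_mul_of_nonneg_right h6 (norm_nonneg _)
  have h7 := ((h1.const_mul (2 * M)).add (h3.const_mul (M + 4 * K)))
  simp only [mul_zero, add_zero] at h7
  refine h7.congr fun N => ?_
  rw [hsn]
  ring

end Skew

/-! ### Integration along the flow and removal of the regularization. -/

theorem exists_abs_angleProfileDeriv_le {r : ℝ} (hr0 : 0 ≤ r) (hr1 : r < 1) :
    ∃ M : ℝ, ∀ x ∈ Set.Icc (-1 : ℝ) 1, |angleProfileDeriv r x| ≤ M := by
  obtain ⟨K, hK⟩ := exists_lipschitz_angleProfileDeriv hr0 hr1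
  exact isCompact_Icc.exists_bound_of_continuousOn hK.continuousOn

theorem sum_angleProfile_doubleCosine_le {n k m : ℕ} (hm : m ≤ k) {r : ℝ} (hr0 : 0 ≤ r)
    (hr1 : r < 1) {X : Matrix (Fin n) (Fin n) ℂ} (hX : X.IsHermitian)
    {S : Submodule ℂ (EuclideanSpace ℂ (Fin n))} (hS : Module.finrank ℂ S = k) :
    ∑ j ∈ Finset.univ.filter (fun j : Fin k => (j : ℕ) < m), angleProfile r
        (doubleCosine k S (S.map (Matrix.toEuclideanLin (NormedSpace.exp (Complex.I • X)))) j) ≤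
      ∑ _j ∈ Finset.univ.filter (fun j : Fin k => (j : ℕ) < m), angleProfile r 1 +
        discrepancyNorm X (min m (n - k)) := by
  obtain ⟨K, hK0, hK⟩ := exists_angleProfile_lower_bound hr0 hr1
  obtain ⟨M, hM⟩ := exists_abs_angleProfileDeriv_le hr0 hr1
  -- The one-step estimate bounds the old angles by the new ones, so the flow must end at `S`: with
  -- this sign it starts from `e^{iX} S` at time `-1` and reaches `S` at time `0`.
  set G : EuclideanSpace ℂ (Fin n) →L[ℂ] EuclideanSpace ℂ (Fin n) :=
    -(Complex.I • Matrix.toEuclideanCLM (n := Fin n) (𝕜 := ℂ) X) with hGdef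
  have hG : G ∈ skewAdjoint _ := by
    rw [skewAdjoint.mem_iff, star_neg, star_smul, ← map_star, Matrix.star_eq_conjTranspose, hX.eq,
      show star Complex.I = -Complex.I from Complex.conj_I, hGdef,
      neg_smul Complex.I (Matrix.toEuclideanCLM (n := Fin n) (𝕜 := ℂ) X)]
  have hXs := Matrix.isSymmetric_toEuclideanLin_iff.2 hX
  have hGX : ∀ x y, ‖⟪x, G y⟫_ℂ‖ = ‖⟪Matrix.toEuclideanLin X y, x⟫_ℂ‖ := by
    intro x y
    have : G y = -(Complex.I • Matrix.toEuclideanLin X y) := rfl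
    rw [this, inner_neg_right, norm_neg, inner_smul_right, norm_mul, Complex.norm_I, one_mul,
      norm_inner_symm]
  set V : ℝ → EuclideanSpace ℂ (Fin n) →L[ℂ] EuclideanSpace ℂ (Fin n) :=
    fun t => NormedSpace.exp ((t : ℂ) • G) with hV
  have hVinner : ∀ t x y, ⟪V t x, V t y⟫_ℂ = ⟪x, y⟫_ℂ := fun t x y =>
    inner_exp_exp_of_mem_skewAdjoint (ofReal_smul_mem_skewAdjoint hG t) x y
  have hVinj : ∀ t, Function.Injective (V t) := fun t x y h => by
    rw [← sub_eq_zero, ← norm_eq_zero, ← norm_map_of_inner_map_map (hVinner t), map_sub, h,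
      sub_self, norm_zero]
  have hV1 : S.map (Matrix.toEuclideanLin (NormedSpace.exp (Complex.I • X))) =
      S.map (V (-1)).toLinearMap := by
    rw [← Matrix.coe_toEuclideanCLM_eq_toEuclideanLin, toEuclideanCLM_exp, map_smul]
    simp [hV, hGdef]
  have hV0 : S.map (V 0).toLinearMap = S := by
    have h1 : V 0 = 1 := by
      simp only [hV, Complex.ofReal_zero]
      rw [zero_smul ℂ G, NormedSpace.exp_zero]
    rw [h1]
    exact Submodule.map_id S
  have hdim : ∀ t, Module.finrank ℂ (S.map (V t).toLinearMap) = k := fun t => by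
    rw [← hS]
    exact (Submodule.equivMapOfInjective _ (hVinj t) S).finrank_eq.symm
  set F : ℝ → ℝ := fun t => ∑ j ∈ Finset.univ.filter (fun j : Fin k => (j : ℕ) < m),
    angleProfile r (doubleCosine k S (S.map (V t).toLinearMap) j) with hF
  set err : ℝ → ℝ := fun s => M * (2 * ‖V s - 1 - (s : ℂ) • G‖ + ‖V s - 1‖ ^ 2)
    + K * (2 * ‖V s - 1‖) ^ 2 with herr
  have hstep : ∀ s t, 0 ≤ s →
      F t ≤ F (s + t) + s * discrepancyNorm X (min m (n - k)) + m * err s := by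
    intro s t hs
    obtain ⟨b, hb, hspan⟩ := exists_isEigenframe (S := S) (hdim t)
    obtain ⟨b', hb', hspan'⟩ := exists_isEigenframe (S := S) (hdim (s + t))
    refine hb.sum_angleProfile_le hm hr0 hr1 hK0 hK hM inner_reflection_left hb' (hVinner s) ?_ X
      (re_inner_apply_eq_zero_of_mem_skewAdjoint hG) hGX hs
    rw [hspan, hspan', ← Submodule.map_comp]
    congr 1
    simp only [hV]
    rw [← exp_smul_mul_exp_smul]
    rfl
  have hiter : ∀ s, 0 ≤ s → ∀ N : ℕ,
      F (-(N * s)) ≤ F 0 + N * (s * discrepancyNorm X (min m (n - k)) + m * err s) := by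
    intro s hs N
    induction N with
    | zero => simp
    | succ N ih =>
      have h := hstep s (-((N + 1 : ℕ) * s)) hs
      rw [show s + -(((N + 1 : ℕ) : ℝ) * s) = -(N * s) by push_cast; ring] at h
      push_cast at h ⊢
      linarith
  have hN : ∀ N : ℕ, F (-1) ≤ F 0 + discrepancyNorm X (min m (n - k)) +
      m * (((N : ℝ) + 1) * err (1 / ((N : ℝ) + 1))) := by
    intro N
    have hN0 : (N : ℝ) + 1 ≠ 0 := by positivity
    have h := hiter (1 / ((N : ℝ) + 1)) (by positivity) (N + 1)
    push_cast at h
    rw [mul_one_div_cancel hN0] at h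
    refine h.trans (le_of_eq ?_)
    rw [mul_add, ← mul_assoc, mul_one_div_cancel hN0]
    ring
  have hlim := ((tendsto_flow_error G M K).const_mul (m : ℝ)).const_add
    (F 0 + discrepancyNorm X (min m (n - k)))
  rw [mul_zero, add_zero] at hlim
  have hfin := ge_of_tendsto' hlim hN
  have hF0 : F 0 = ∑ j ∈ Finset.univ.filter (fun j : Fin k => (j : ℕ) < m), angleProfile r 1 := by
    simp only [hF, hV0, doubleCosine_self hS]
  rw [hV1, ← hF0]
  exact hfin

theorem continuous_angleProfile_left (x : ℝ) : Continuous fun r => angleProfile r x :=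
  ((Real.continuous_arcsin.comp (continuous_id.mul_const x)).div_const 2).neg

/-- The double-angle formula, with `2 arccos c` in `[0, π]` because `c ≥ 0`; the subtracted constant
is `-π/4`. -/
theorem arccos_eq_angleProfile_sub {c : ℝ} (h0 : 0 ≤ c) (h1 : c ≤ 1) :
    Real.arccos c = angleProfile 1 (2 * c ^ 2 - 1) - angleProfile 1 1 := by
  have h2 : Real.arccos (2 * c ^ 2 - 1) = 2 * Real.arccos c := by
    have h3 : Real.cos (2 * Real.arccos c) = 2 * c ^ 2 - 1 := by
      rw [Real.cos_two_mul, Real.cos_arccos (by linarith) h1]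
    rw [← h3, Real.arccos_cos (by linarith [Real.arccos_nonneg c])
      (by linarith [Real.arccos_le_pi_div_two.2 h0])]
  rw [Real.arccos_eq_pi_div_two_sub_arcsin (2 * c ^ 2 - 1)] at h2
  simp only [angleProfile, one_mul, Real.arcsin_one]
  linarith

theorem principalCosine_le_one {n k : ℕ} {S T : Submodule ℂ (EuclideanSpace ℂ (Fin n))}
    (hT : Module.finrank ℂ T = k) (i : Fin k) : principalCosine S T i ≤ 1 := by
  obtain ⟨b, hb, -⟩ := exists_isEigenframe (S := S) hT
  have h := (hb.mem_Icc i.rev).2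
  rw [doubleCosine, Fin.rev_rev] at h
  nlinarith [principalCosine_nonneg (S := S) (T := T) i]

/-- The `m` largest principal angles between `S` and `e^{iX} S` add up to at most a discrepancy
norm of `X`. -/
theorem sum_principalAngles_rev_le {n k m : ℕ} (hm : m ≤ k) {X : Matrix (Fin n) (Fin n) ℂ}
    (hX : X.IsHermitian) {S T : Submodule ℂ (EuclideanSpace ℂ (Fin n))}
    (hS : Module.finrank ℂ S = k) (hTk : Module.finrank ℂ T = k)
    (hT : T = S.map (Matrix.toEuclideanLin (NormedSpace.exp (Complex.I • X)))) :
    ∑ j ∈ Finset.univ.filter (fun j : Fin k => (j : ℕ) < m), principalAngles k S T j.rev ≤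
      discrepancyNorm X (min m (n - k)) := by
  set f : ℝ → ℝ := fun r => ∑ j ∈ Finset.univ.filter (fun j : Fin k => (j : ℕ) < m),
    (angleProfile r (doubleCosine k S T j) - angleProfile r 1) with hf
  have hcont : Continuous f := continuous_finsetSum _ fun j _ =>
    (continuous_angleProfile_left _).sub (continuous_angleProfile_left _)
  have hle : ∀ N : ℕ, f (1 - 1 / ((N : ℝ) + 1)) ≤ discrepancyNorm X (min m (n - k)) := by
    intro N
    have h1 : 1 / ((N : ℝ) + 1) ≤ 1 := by
      rw [div_le_one (by positivity)]; linarith [(Nat.cast_nonneg N : (0 : ℝ) ≤ N)]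
    have h2 : 0 < 1 / ((N : ℝ) + 1) := by positivity
    have := sum_angleProfile_doubleCosine_le hm (r := 1 - 1 / ((N : ℝ) + 1)) (by linarith)
      (by linarith) hX hS
    rw [← hT] at this
    simp only [hf, Finset.sum_sub_distrib]
    linarith
  have hlim : Filter.Tendsto (fun N : ℕ => f (1 - 1 / ((N : ℝ) + 1))) Filter.atTop
      (nhds (f 1)) := by
    refine (hcont.tendsto 1).comp ?_
    simpa using (tendsto_one_div_add_atTop_nhds_zero_nat (𝕜 := ℝ)).const_sub 1
  refine le_trans (le_of_eq (Finset.sum_congr rfl fun j _ => ?_)) (le_of_tendsto' hlim hle)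
  exact arccos_eq_angleProfile_sub (principalCosine_nonneg _) (principalCosine_le_one hTk j.rev)

theorem finrank_map_exp {n : ℕ} {X : Matrix (Fin n) (Fin n) ℂ}
    (S : Submodule ℂ (EuclideanSpace ℂ (Fin n))) :
    Module.finrank ℂ (S.map (Matrix.toEuclideanLin (NormedSpace.exp X))) =
      Module.finrank ℂ S := by
  have hinj : Function.Injective (Matrix.toEuclideanLin (NormedSpace.exp X)) := by
    have hu : IsUnit (Matrix.toEuclideanCLM (n := Fin n) (𝕜 := ℂ) (NormedSpace.exp X)) :=
      (Matrix.isUnit_exp X).map _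
    obtain ⟨u, hu⟩ := hu
    have h1 : ∀ x, (u⁻¹ : (EuclideanSpace ℂ (Fin n) →L[ℂ] EuclideanSpace ℂ (Fin n))ˣ).1
        (Matrix.toEuclideanLin (NormedSpace.exp X) x) = x := by
      intro x
      rw [← Matrix.coe_toEuclideanCLM_eq_toEuclideanLin, ← hu]
      exact congrArg (fun L : EuclideanSpace ℂ (Fin n) →L[ℂ] EuclideanSpace ℂ (Fin n) => L x)
        u.inv_mul
    exact Function.LeftInverse.injective h1
  exact (Submodule.equivMapOfInjective _ hinj S).finrank_eq.symm

end Discrepancy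

end
theorem mainTheorem8 (n k : ℕ) (X : Matrix (Fin n) (Fin n) ℂ) (hX : X.IsHermitian)
    (S T : Submodule ℂ (EuclideanSpace ℂ (Fin n))) (hS : Module.finrank ℂ S = k)
    (hT : T = S.map (Matrix.toEuclideanLin (NormedSpace.exp (Complex.I • X)))) :
    Discrepancy.WeaklyMajorized (Discrepancy.principalAngles k S T)
      (Discrepancy.firstDiscrepancyValues X (min k (n - k)) k) := by
  intro m _ hm
  have hTk : Module.finrank ℂ T = k := by rw [hT, Discrepancy.finrank_map_exp, hS]
  have hmono : Monotone (Discrepancy.principalAngles k S T) := fun i j hij =>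
    Real.antitone_arccos (Discrepancy.antitone_principalCosine (Fin.val_fin_le.2 hij))
  -- The angles increase with the index, so their `m` largest are read off in reverse. The
  -- truncation at `min k (n - k)` agrees with the index `min m (n - k)` because `m ≤ k`.
  refine le_trans ?_ (Discrepancy.sum_filter_le_sum_decreasing hm _)
  rw [Discrepancy.sum_firstDiscrepancyValues X _ hm, Discrepancy.discrepancyNorm_zero, sub_zero,
    ← min_assoc, min_eq_left hm,
    Finset.sum_congr rfl fun i _ => Discrepancy.decreasing_of_monotone hmono i]
  exact Discrepancy.sum_principalAngles_rev_le hm hX hS hTk hT
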